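/- **Theorem.** Let $U\subset\mathbb{R}^n$ be open and convex and let $f:U\to\mathbb{R}^n$ be continuous and tame, meaning that its graph, as a subset of $\mathbb{R}^{2n}$, is definable in some o-minimal structure on the real field $(\mathbb{R},+,\cdot)$ or is subanalytic in $\mathbb{R}^{2n}$. Suppose there is a nowhere dense set $B\subset U$, closed in $U$, such that $f$ is of class $C^1$ on $U\setminus B$, the Jacobi matrix $df(x)$ is non-singular for every $x\in U\setminus B$, and * the convex hull of $\{df(x) : x\in U\setminus B\}$ in the space of real $n\times n$ matrices contains no singular matrix; * $f$ is injective on $B$. Then $f$ is injective on $U$. Here an *o-minimal structure on the real field* is a sequence $(S_k)_{k\ge 0}$, $S_k$ a family of subsets of $\mathbb{R}^k$, such that each $S_k$ is closed under finite unions and complements and contains the zero set of every real polynomial in $k$ variables, $A\times A'\in S_{k+l}$ for $A\in S_k$ and $A'\in S_l$, the projection to $\mathbb{R}^k$ (first $k$ coordinates) of each member of $S_{k+1}$ lies in $S_k$, and $S_1$ consists exactly of the finite unions of points and (possibly unbounded) open intervals; a set in $S_k$ is called definable. A set $X\subset\mathbb{R}^k$ is *semianalytic* if every point of $\mathbb{R}^k$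 has an open neighbourhood $V$ such that $X\cap V$ is a finite Boolean combination of sets $\{x\in V: g(x)=0\}$ and $\{x\in V: g(x)>0\}$ with $g:V\to\mathbb{R}$ real analytic. It is *subanalytic* if every point of $\mathbb{R}^k$ has an open neighbourhood $V$ such that $X\cap V$ is the image of a bounded semianalytic set $Y\subset\mathbb{R}^{k+m}$, for some $m\ge 0$, under the projection to $\mathbb{R}^k$. -/

import Mathlib

/-- A subset of the real line is a finite union of points and open intervals `(a, b)` with
`-∞ ≤ a, b ≤ +∞`. -/
def IsFiniteUnionOfIntervals (A : Set ℝ) : Prop :=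
  ∃ F : Set (Set ℝ), F.Finite ∧
    (∀ I ∈ F, (∃ t : ℝ, I = {t}) ∨ (∃ a b : EReal, I = {t : ℝ | a < (t : EReal) ∧ (t : EReal) < b})) ∧
    A = ⋃₀ F

/-- The collection `S`, where `S n` is a family of subsets of `ℝⁿ`, is an o-minimal structure
on the real field `(ℝ, +, ·)`. The members of `S n` are the definable subsets of `ℝⁿ`. -/
structure IsOMinimalStructure (S : ∀ n : ℕ, Set (Set (Fin n → ℝ))) : Prop where
  union_mem : ∀ (n : ℕ) (A B : Set (Fin n → ℝ)), A ∈ S n → B ∈ S n → A ∪ B ∈ S n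
  compl_mem : ∀ (n : ℕ) (A : Set (Fin n → ℝ)), A ∈ S n → Aᶜ ∈ S n
  prod_mem : ∀ (m n : ℕ) (A : Set (Fin m → ℝ)) (B : Set (Fin n → ℝ)), A ∈ S m → B ∈ S n →
    {z : Fin (m + n) → ℝ | (fun i => z (Fin.castAdd n i)) ∈ A ∧
      (fun j => z (Fin.natAdd m j)) ∈ B} ∈ S (m + n)
  proj_mem : ∀ (n : ℕ) (A : Set (Fin (n + 1) → ℝ)), A ∈ S (n + 1) →
    (fun (z : Fin (n + 1) → ℝ) (i : Fin n) => z (Fin.castSucc i)) '' A ∈ S n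
  zeros_mem : ∀ (n : ℕ) (p : MvPolynomial (Fin n) ℝ),
    {x : Fin n → ℝ | MvPolynomial.eval x p = 0} ∈ S n
  mem_one_iff : ∀ A : Set (Fin 1 → ℝ),
    A ∈ S 1 ↔ IsFiniteUnionOfIntervals {t : ℝ | (fun _ => t) ∈ A}

/-- `X ⊆ ℝⁿ` is semianalytic: every point of `ℝⁿ` has an open neighbourhood `V` such that
`X ∩ V` is a finite Boolean combination of sets `{x ∈ V | g x = 0}` and `{x ∈ V | g x > 0}`
with `g` real analytic on `V`. -/
def IsSemianalytic {n : ℕ} (X : Set (Fin n → ℝ)) : Prop :=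
  ∀ x : Fin n → ℝ, ∃ V : Set (Fin n → ℝ), IsOpen V ∧ x ∈ V ∧
    ∃ A ∈ BooleanSubalgebra.closure {A : Set (Fin n → ℝ) | ∃ g : (Fin n → ℝ) → ℝ,
        AnalyticOnNhd ℝ g V ∧ (A = {y | g y = 0} ∨ A = {y | 0 < g y})},
      X ∩ V = A ∩ V

/-- `X ⊆ ℝⁿ` is subanalytic: every point of `ℝⁿ` has an open neighbourhood `V` such that
`X ∩ V` is the image of a bounded semianalytic set `Y ⊆ ℝⁿ⁺ᵐ` under the projection to the
first `n` coordinates. -/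
def IsSubanalytic {n : ℕ} (X : Set (Fin n → ℝ)) : Prop :=
  ∀ x : Fin n → ℝ, ∃ V : Set (Fin n → ℝ), IsOpen V ∧ x ∈ V ∧
    ∃ (m : ℕ) (Y : Set (Fin (n + m) → ℝ)), Bornology.IsBounded Y ∧ IsSemianalytic Y ∧
      X ∩ V = (fun (y : Fin (n + m) → ℝ) (i : Fin n) => y (Fin.castAdd m i)) '' Y

/-- The graph of `f : U → ℝⁿ`, `U ⊆ ℝᵐ`, as a subset of `ℝᵐ⁺ⁿ`. -/
def graphOver {m n : ℕ} (U : Set (Fin m → ℝ)) (f : (Fin m → ℝ) → (Fin n → ℝ)) :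
    Set (Fin (m + n) → ℝ) :=
  {z | ∃ x ∈ U, z = Fin.append x (f x)}

/-- `f : U → ℝⁿ` is tame: its graph is definable in some o-minimal structure or subanalytic. -/
def IsTameOn {m n : ℕ} (f : (Fin m → ℝ) → (Fin n → ℝ)) (U : Set (Fin m → ℝ)) : Prop :=
  (∃ S : ∀ k : ℕ, Set (Set (Fin k → ℝ)), IsOMinimalStructure S ∧ graphOver U f ∈ S (m + n)) ∨
    IsSubanalytic (graphOver U f)

/-- The Jacobi matrix of `f` at `x`. -/
noncomputable def jacobiMatrix {n : ℕ} (f : (Fin n → ℝ) → (Fin n → ℝ)) (x : Fin n → ℝ) :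
    Matrix (Fin n) (Fin n) ℝ :=
  LinearMap.toMatrix' (fderiv ℝ f x : (Fin n → ℝ) →ₗ[ℝ] (Fin n → ℝ))

/-!
Why the theorem holds. Suppose `f a = f b` with `a ≠ b`. Off `B`, `f` is a local diffeomorphism, and
as `f` is injective on `B` at least one of `a`, `b` is off `B`; moving the pair slightly
(`exists_ne_eq_of_mem_diff`), both are. The pairs with `f a = f b` near the given one form a
manifold, and for each `t ∈ (0, 1)` the map `(a, b) ↦ (1 - t) a + t b` is a local diffeomorphism on
it: this amounts to `t df(a) + (1 - t) df(b)` being nonsingular, which is the convex hull hypothesis.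
By the Baire category theorem a generic pair spans a segment that meets `B` only in a nowhere dense
set of parameters (`exists_segment_dense_diff`).

Along such a segment, with direction `w = b - a`, the curve `g` obtained from `f` has velocity
`df(x) w` on an open dense set `D` of parameters, and `g 0 = g 1`. If `0` were not in the convex hull
of these velocities, a linear functional `l` would be nonnegative on them and not identically zero
(`Convex.exists_linear_nonneg_and_pos`). If one knows that `l ∘ g` is then monotone, it is constant,
so that `l` vanishes on all velocities, a contradiction (`zero_mem_convexHull_image_deriv`). Hence
`A w = 0` for some `A` in the convex hull of the Jacobi matrices, which is impossible.

Tameness enters only in the monotonicity of `l ∘ g`, as `D` may have a complement of positive measure.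
It suffices that `l ∘ g` is locally monotone off a countable set
(`le_of_locally_monotone_off_countable`). In the o-minimal case the set where this fails is definable
and has empty interior, so it is finite (`IsOMinimalStructure.locally_monotone_off_countable`). In the
subanalytic case `g` is `C¹` off a countable set
(`IsSubanalytic.countable_setOf_not_contDiffAt`), and at its `C¹` points the sign of the derivative
extends from `D` by continuity. The subanalytic case needs no theory of semianalytic sets beyond a
countable decomposition into analytic pieces: such a set is split along the hypersurfaces where an
analytic function vanishes and one of its directional derivatives does not, by induction on the
dimension (`countable_not_contDiffAt_of_comp_eq`).
-/

open Set Filter Topology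
open scoped ContDiff

/-! ### Monotonicity, separation and a mean value theorem -/

/-- Adding `ε t` makes `h` strictly increasing near every point off `N` without destroying a drop
`h b < h a`. Since `N` is countable, some value `c` in between is not taken on `N`, and the last
time at which the perturbed function is `≥ c` gives a contradiction. -/
lemma le_of_locally_monotone_off_countable {h : ℝ → ℝ} {a b : ℝ} (hab : a ≤ b)
    (hc : ContinuousOn h (Icc a b)) {N : Set ℝ} (hN : N.Countable)
    (hm : ∀ t ∈ Ioo a b, t ∉ N → ∃ u ∈ 𝓝 t, MonotoneOn h u) : h a ≤ h b := by
  by_contra! hlt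
  have hab' : a < b := lt_of_le_of_ne hab (by rintro rfl; exact lt_irrefl _ hlt)
  obtain ⟨ε, hε, hεlt⟩ : ∃ ε : ℝ, 0 < ε ∧ ε * (b - a) < h a - h b := by
    refine ⟨(h a - h b) / (2 * (b - a)), div_pos (by linarith) (by linarith), ?_⟩
    have : b - a ≠ 0 := by linarith
    field_simp
    linarith
  set k : ℝ → ℝ := fun t => h t + ε * t with hk
  have hkc : ContinuousOn k (Icc a b) := hc.add (by fun_prop)
  have hkab : k b < k a := by simp only [hk]; nlinarith
  obtain ⟨c, ⟨hcb, hca⟩, hcN⟩ : ∃ c ∈ Ioo (k b) (k a), c ∈ (k '' N)ᶜ :=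
    ((hN.image k).dense_compl ℝ).inter_open_nonempty _ isOpen_Ioo (nonempty_Ioo.2 hkab)
  have hcomp : IsCompact (Icc a b ∩ k ⁻¹' Ici c) :=
    isCompact_Icc.of_isClosed_subset (hkc.preimage_isClosed_of_isClosed isClosed_Icc isClosed_Ici)
      inter_subset_left
  obtain ⟨t₀, ⟨ht₀, hct⟩, hmax⟩ :=
    hcomp.exists_isGreatest ⟨a, left_mem_Icc.2 hab, hca.le⟩
  have hkt : k t₀ = c := by
    obtain ⟨t₁, ht₁, hk₁⟩ := intermediate_value_Icc' ht₀.2 (hkc.mono (Icc_subset_Icc_left ht₀.1))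
      ⟨hcb.le, hct⟩
    have : t₁ ≤ t₀ := hmax ⟨⟨ht₀.1.trans ht₁.1, ht₁.2⟩, hk₁.ge⟩
    rw [← hk₁, le_antisymm this ht₁.1]
  have hlta : a < t₀ := lt_of_le_of_ne ht₀.1 (by rintro rfl; exact hca.ne' hkt)
  have hltb : t₀ < b := lt_of_le_of_ne ht₀.2 (by rintro rfl; exact hcb.ne hkt)
  obtain ⟨u, hu, hmono⟩ := hm t₀ ⟨hlta, hltb⟩ fun hmem => hcN ⟨t₀, hmem, hkt⟩
  have h1 : ∀ᶠ t in 𝓝[>] t₀, t ∈ u ∧ t < b :=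
    nhdsWithin_le_nhds (inter_mem hu (Iio_mem_nhds hltb))
  obtain ⟨t, ⟨htu, htb⟩, htt⟩ := (h1.and self_mem_nhdsWithin).exists
  have htt : t₀ < t := htt
  have h2 := hmono (mem_of_mem_nhds hu) htu htt.le
  have h3 : c ≤ k t := by rw [← hkt]; simp only [hk]; nlinarith
  exact absurd (hmax ⟨⟨by linarith, htb.le⟩, h3⟩) (not_le.2 htt)

/-- Proper separation of a convex set from a point outside it. The convex set need not be closed, so
strict separation is not available; in the span of `K`, however, the hull of `K ∪ {0}` has nonempty
interior and `0` lies on its boundary. -/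
lemma Convex.exists_linear_nonneg_and_pos {E : Type*} [NormedAddCommGroup E] [NormedSpace ℝ E]
    [FiniteDimensional ℝ E] {K : Set E} (hK : Convex ℝ K) (hne : K.Nonempty) (h0 : (0 : E) ∉ K) :
    ∃ l : E →ₗ[ℝ] ℝ, (∀ x ∈ K, 0 ≤ l x) ∧ ∃ x ∈ K, 0 < l x := by
  set W := Submodule.span ℝ K with hW
  set K' : Set W := Subtype.val ⁻¹' K with hK'
  have hKc : Convex ℝ K' := hK.linear_preimage W.subtype
  have h0' : (0 : W) ∉ K' := h0
  have hne' : K'.Nonempty := by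
    obtain ⟨x, hx⟩ := hne
    exact ⟨⟨x, Submodule.subset_span hx⟩, hx⟩
  have hspan : Submodule.span ℝ K' = ⊤ := Submodule.span_span_coe_preimage
  set C : Set W := convexHull ℝ (insert 0 K') with hC
  have hint : (interior C).Nonempty := by
    rw [hC, interior_convexHull_nonempty_iff_affineSpan_eq_top]
    apply SetLike.coe_injective
    rw [affineSpan_insert_zero, hspan]
    rfl
  -- If `0` were interior, a small negative multiple of some `x ∈ K` would be a nonnegative multiple
  -- of some `y ∈ K`, and then `0` would lie between `x` and `y`.
  have h0C : (0 : W) ∉ interior C := by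
    intro hmem
    obtain ⟨x, hx⟩ := hne'
    have ht : Tendsto (fun r : ℝ => -(r • x)) (𝓝[>] 0) (𝓝 0) := by
      have : Continuous (fun r : ℝ => -(r • x)) := by fun_prop
      simpa using (this.tendsto 0).mono_left nhdsWithin_le_nhds
    have h1 := ht.eventually (mem_interior_iff_mem_nhds.1 hmem)
    obtain ⟨r, hr, hr0⟩ := (h1.and self_mem_nhdsWithin).exists
    have hr0 : 0 < r := hr0
    change -(r • x) ∈ C at hr
    rw [hC, convexHull_insert ⟨x, hx⟩, hKc.convexHull_eq, convexJoin_singleton_left] at hr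
    simp only [mem_iUnion] at hr
    obtain ⟨y, hy, α, β, hα, hβ, hαβ, hz⟩ := hr
    rw [smul_zero, zero_add] at hz
    have hs : 0 < β + r := by linarith
    have := hKc hy hx (a := β / (β + r)) (b := r / (β + r)) (by positivity) (by positivity)
      (by field_simp)
    apply h0'
    convert this using 1
    rw [div_eq_inv_mul, div_eq_inv_mul, mul_smul, mul_smul, ← smul_add, hz]
    simp
  obtain ⟨l, hl, hlt⟩ :=
    geometric_hahn_banach_of_nonempty_interior_point (convex_convexHull ℝ _) h0C hint
  simp only [map_zero] at hlt
  obtain ⟨m, hm⟩ := LinearMap.exists_extend (-(l : W →ₗ[ℝ] ℝ))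
  have hml : ∀ x : W, m x = -l x := fun x => by
    have := LinearMap.congr_fun hm x
    simpa using this
  have hnonneg : ∀ x ∈ K, 0 ≤ m x := fun x hx => by
    have h1 := hlt ⟨x, Submodule.subset_span hx⟩ (subset_convexHull ℝ _ (mem_insert_of_mem _ hx))
    have h2 := hml ⟨x, Submodule.subset_span hx⟩
    simp only at h2
    linarith
  refine ⟨m, hnonneg, ?_⟩
  by_contra! hle
  apply hl
  have : (l : W →ₗ[ℝ] ℝ) = 0 := by
    refine LinearMap.ext_on hspan fun x hx => ?_
    have h1 := hml x
    have h2 := hnonneg x hx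
    have h3 := hle x hx
    simp only [ContinuousLinearMap.coe_coe, LinearMap.zero_apply]
    linarith
  ext x
  exact LinearMap.congr_fun this x

/-- A mean value theorem for a closed curve `g` that is differentiable only on an open set `D`: the
origin is in the convex hull of the velocities on `D` itself (no closure is taken), provided every
linear functional that is nonnegative on these velocities is locally monotone along `g` off a
countable set. A properly separating functional would be constant along `g`. -/
lemma zero_mem_convexHull_image_deriv {E : Type*} [NormedAddCommGroup E] [NormedSpace ℝ E]
    [FiniteDimensional ℝ E] {g g' : ℝ → E} {D : Set ℝ} (hg : ContinuousOn g (Icc 0 1))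
    (h01 : g 0 = g 1) (hD : D ⊆ Ioo 0 1) (hDo : IsOpen D) (hDne : D.Nonempty)
    (hder : ∀ t ∈ D, HasDerivAt g (g' t) t)
    (htame : ∀ l : E →ₗ[ℝ] ℝ, (∀ t ∈ D, 0 ≤ l (g' t)) →
      ∃ N : Set ℝ, N.Countable ∧
        ∀ t ∈ Ioo (0 : ℝ) 1, t ∉ N → ∃ u ∈ 𝓝 t, MonotoneOn (fun s => l (g s)) u) :
    (0 : E) ∈ convexHull ℝ (g' '' D) := by
  by_contra h0
  obtain ⟨l, hl, x, hx, hlx⟩ := (convex_convexHull ℝ (g' '' D)).exists_linear_nonneg_and_pos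
    ((hDne.image g').convexHull) h0
  have hlc : Continuous l := l.continuous_of_finiteDimensional
  obtain ⟨N, hN, hmono⟩ := htame l fun t ht => hl _ (subset_convexHull ℝ _ (mem_image_of_mem _ ht))
  have hhc : ContinuousOn (fun s => l (g s)) (Icc 0 1) := hlc.comp_continuousOn hg
  have hle : ∀ s t : ℝ, 0 ≤ s → s ≤ t → t ≤ 1 → l (g s) ≤ l (g t) := fun s t hs hst ht =>
    le_of_locally_monotone_off_countable hst (hhc.mono (Icc_subset_Icc hs ht)) hN
      fun r hr => hmono r ⟨hs.trans_lt hr.1, hr.2.trans_le ht⟩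
  have hconst : ∀ t ∈ Ioo (0 : ℝ) 1, l (g t) = l (g 0) := fun t ht =>
    le_antisymm (by rw [h01]; exact hle t 1 ht.1.le ht.2.le le_rfl) (hle 0 t le_rfl ht.1.le ht.2.le)
  have hzero : ∀ t ∈ D, l (g' t) = 0 := fun t ht => by
    have h1 : HasDerivAt (fun s => l (g s)) (l (g' t)) t :=
      (LinearMap.toContinuousLinearMap l).hasFDerivAt.comp_hasDerivAt t (hder t ht)
    have h2 : HasDerivAt (fun s => l (g s)) 0 t :=
      (hasDerivAt_const t (l (g 0))).congr_of_eventuallyEq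
        (eventually_of_mem (hDo.mem_nhds ht) fun s hs => hconst s (hD hs))
    exact h1.unique h2
  have hsub : convexHull ℝ (g' '' D) ⊆ (LinearMap.ker l : Set E) := by
    refine convexHull_min ?_ (LinearMap.ker l).convex
    rintro _ ⟨t, ht, rfl⟩
    exact hzero t ht
  have : l x = 0 := hsub hx
  exact hlx.ne' this

/-! ### Definable functions of one variable -/

/-- `φ : ℝⁿ → ℝ` is a polynomial function. -/
def IsPolynomialMap {n : ℕ} (φ : (Fin n → ℝ) → ℝ) : Prop :=
  ∃ p : MvPolynomial (Fin n) ℝ, ∀ x, MvPolynomial.eval x p = φ x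

namespace IsPolynomialMap

variable {n : ℕ} {φ ψ : (Fin n → ℝ) → ℝ}

lemma const (c : ℝ) : IsPolynomialMap fun _ : Fin n → ℝ => c :=
  ⟨MvPolynomial.C c, fun x => by simp⟩

lemma coord (i : Fin n) : IsPolynomialMap fun x : Fin n → ℝ => x i :=
  ⟨MvPolynomial.X i, fun x => by simp⟩

lemma add (hφ : IsPolynomialMap φ) (hψ : IsPolynomialMap ψ) :
    IsPolynomialMap fun x => φ x + ψ x := by
  obtain ⟨p, hp⟩ := hφ
  obtain ⟨q, hq⟩ := hψ
  exact ⟨p + q, fun x => by simp [hp, hq]⟩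

lemma mul (hφ : IsPolynomialMap φ) (hψ : IsPolynomialMap ψ) :
    IsPolynomialMap fun x => φ x * ψ x := by
  obtain ⟨p, hp⟩ := hφ
  obtain ⟨q, hq⟩ := hψ
  exact ⟨p * q, fun x => by simp [hp, hq]⟩

lemma sub (hφ : IsPolynomialMap φ) (hψ : IsPolynomialMap ψ) :
    IsPolynomialMap fun x => φ x - ψ x := by
  obtain ⟨p, hp⟩ := hφ
  obtain ⟨q, hq⟩ := hψ
  exact ⟨p - q, fun x => by simp [hp, hq]⟩

lemma sum {ι : Type*} (s : Finset ι) {φ : ι → (Fin n → ℝ) → ℝ}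
    (hφ : ∀ i, IsPolynomialMap (φ i)) : IsPolynomialMap fun x => ∑ i ∈ s, φ i x := by
  choose p hp using hφ
  exact ⟨∑ i ∈ s, p i, fun x => by simp [hp]⟩

lemma comp_coord {m : ℕ} (hφ : IsPolynomialMap φ) (σ : Fin n → Fin m) :
    IsPolynomialMap fun x : Fin m → ℝ => φ fun i => x (σ i) := by
  obtain ⟨p, hp⟩ := hφ
  exact ⟨MvPolynomial.rename σ p, fun x => by
    rw [MvPolynomial.eval_rename, hp]; rfl⟩

lemma linear (l : (Fin n → ℝ) →ₗ[ℝ] ℝ) : IsPolynomialMap fun x => l x := by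
  have h : (fun x => l x) = fun x => ∑ i, x i * l (Pi.single i 1) := by
    funext x
    conv_lhs => rw [← Finset.univ_sum_single x, map_sum]
    refine Finset.sum_congr rfl fun i _ => ?_
    rw [← smul_eq_mul, ← map_smul, ← Pi.single_smul]
    simp
  rw [h]
  exact sum _ fun i => (coord i).mul (const _)

end IsPolynomialMap

namespace IsOMinimalStructure

variable {S : ∀ n : ℕ, Set (Set (Fin n → ℝ))}

lemma zeroSet_mem (hS : IsOMinimalStructure S) {n : ℕ} {φ : (Fin n → ℝ) → ℝ}
    (hφ : IsPolynomialMap φ) : {x | φ x = 0} ∈ S n := by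
  obtain ⟨p, hp⟩ := hφ
  simpa [hp] using hS.zeros_mem n p

lemma univ_mem (hS : IsOMinimalStructure S) (n : ℕ) : univ ∈ S n := by
  simpa using hS.zeroSet_mem (IsPolynomialMap.const (n := n) 0)

lemma inter_mem (hS : IsOMinimalStructure S) {n : ℕ} {A B : Set (Fin n → ℝ)} (hA : A ∈ S n)
    (hB : B ∈ S n) : A ∩ B ∈ S n := by
  have := hS.compl_mem n _ (hS.union_mem n _ _ (hS.compl_mem n _ hA) (hS.compl_mem n _ hB))
  rwa [compl_union, compl_compl, compl_compl] at this

lemma biInter_mem (hS : IsOMinimalStructure S) {n : ℕ} {ι : Type*} (s : Finset ι)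
    {A : ι → Set (Fin n → ℝ)} (hA : ∀ i, A i ∈ S n) : {x | ∀ i ∈ s, x ∈ A i} ∈ S n := by
  classical
  induction s using Finset.induction_on with
  | empty => simpa using hS.univ_mem n
  | insert i s _ ih =>
    have h : {x | ∀ j ∈ insert i s, x ∈ A j} = A i ∩ {x | ∀ j ∈ s, x ∈ A j} := by
      ext x; simp
    rw [h]
    exact hS.inter_mem (hA i) ih

lemma image_castAdd_mem (hS : IsOMinimalStructure S) {n : ℕ} (k : ℕ) :
    ∀ {A : Set (Fin (n + k) → ℝ)}, A ∈ S (n + k) →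
      (fun (z : Fin (n + k) → ℝ) (i : Fin n) => z (Fin.castAdd k i)) '' A ∈ S n := by
  induction k with
  | zero => intro A hA; simpa using hA
  | succ k ih =>
    intro A hA
    have := ih (hS.proj_mem (n + k) A hA)
    rw [image_image] at this
    exact this

lemma exists_append_mem (hS : IsOMinimalStructure S) {n k : ℕ} {A : Set (Fin (n + k) → ℝ)}
    (hA : A ∈ S (n + k)) : {x : Fin n → ℝ | ∃ y : Fin k → ℝ, Fin.append x y ∈ A} ∈ S n := by
  convert hS.image_castAdd_mem k hA using 1
  ext x
  constructor
  · rintro ⟨y, hy⟩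
    exact ⟨_, hy, funext fun i => by simp⟩
  · rintro ⟨z, hz, rfl⟩
    exact ⟨fun j => z (Fin.natAdd n j), by rwa [Fin.append_castAdd_natAdd]⟩

/-- The preimage of `A` is the projection of the part of `ℝⁿ × A` lying on the graph of `φ`. -/
lemma preimage_mem (hS : IsOMinimalStructure S) {n m : ℕ} {A : Set (Fin m → ℝ)} (hA : A ∈ S m)
    {φ : Fin m → (Fin n → ℝ) → ℝ} (hφ : ∀ j, IsPolynomialMap (φ j)) :
    {x | (fun j => φ j x) ∈ A} ∈ S n := by
  have h1 := hS.prod_mem n m univ A (hS.univ_mem n) hA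
  have h2 : {z : Fin (n + m) → ℝ | ∀ j ∈ Finset.univ, z ∈ {z : Fin (n + m) → ℝ |
      z (Fin.natAdd n j) - φ j (fun i => z (Fin.castAdd m i)) = 0}} ∈ S (n + m) :=
    hS.biInter_mem _ fun j =>
      hS.zeroSet_mem ((IsPolynomialMap.coord _).sub ((hφ j).comp_coord _))
  convert hS.exists_append_mem (hS.inter_mem h1 h2) using 1
  ext x
  constructor
  · intro hx
    refine ⟨fun j => φ j x, ⟨trivial, ?_⟩, fun j _ => ?_⟩
    · simpa using hx
    · simp
  · rintro ⟨y, ⟨-, hy⟩, hyj⟩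
    have h3 : y = fun j => φ j x := funext fun j => by
      have := hyj j (Finset.mem_univ j)
      simpa [sub_eq_zero] using this
    change (fun j => φ j x) ∈ A
    rw [← h3]
    simpa using hy

/-- Positivity is an existential polynomial condition: `0 < φ x` iff `φ x * y ^ 2 = 1` for some
`y`. -/
lemma pos_mem (hS : IsOMinimalStructure S) {n : ℕ} {φ : (Fin n → ℝ) → ℝ}
    (hφ : IsPolynomialMap φ) : {x | 0 < φ x} ∈ S n := by
  have h1 : {z : Fin (n + 1) → ℝ | φ (fun i => z (Fin.castAdd 1 i)) *
      (z (Fin.natAdd n 0) * z (Fin.natAdd n 0)) - 1 = 0} ∈ S (n + 1) :=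
    hS.zeroSet_mem (((hφ.comp_coord _).mul
      ((IsPolynomialMap.coord _).mul (IsPolynomialMap.coord _))).sub (IsPolynomialMap.const 1))
  convert hS.exists_append_mem h1 using 1
  ext x
  constructor
  · intro hx
    have hx : 0 < φ x := hx
    have hs : Real.sqrt (φ x) * Real.sqrt (φ x) = φ x := Real.mul_self_sqrt hx.le
    have hs0 : Real.sqrt (φ x) ≠ 0 := (Real.sqrt_pos.2 hx).ne'
    refine ⟨fun _ => (Real.sqrt (φ x))⁻¹, ?_⟩
    simp only [mem_ofPred_eq, Fin.append_left, Fin.append_right]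
    rw [← mul_inv, hs, mul_inv_cancel₀ hx.ne', sub_self]
  · rintro ⟨y, hy⟩
    simp only [mem_ofPred_eq, Fin.append_left, Fin.append_right] at hy ⊢
    by_contra! hle
    nlinarith [mul_nonneg (neg_nonneg.2 hle) (mul_self_nonneg (y 0))]

lemma countable_of_interior_eq_empty (hS : IsOMinimalStructure S) {A : Set ℝ}
    (hA : {x : Fin 1 → ℝ | x 0 ∈ A} ∈ S 1) (hint : interior A = ∅) : A.Countable := by
  obtain ⟨F, hF, hFI, hAF⟩ := (hS.mem_one_iff _).1 hA
  have hAF : A = ⋃₀ F := hAF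
  rw [hAF]
  refine hF.countable.sUnion fun I hI => ?_
  rcases hFI I hI with ⟨t, rfl⟩ | ⟨a, b, rfl⟩
  · exact countable_singleton t
  · have ho : IsOpen {t : ℝ | a < (t : EReal) ∧ (t : EReal) < b} :=
      (isOpen_lt continuous_const continuous_coe_real_ereal).inter
        (isOpen_lt continuous_coe_real_ereal continuous_const)
    have h1 := interior_maximal (hAF ▸ subset_sUnion_of_mem hI) ho
    rw [hint, subset_empty_iff] at h1
    rw [h1]
    exact countable_empty

/-- The points near which a definable function of one variable is not monotone form a definable
set. It has empty interior as soon as the function is locally monotone on a dense set, so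
o-minimality makes it countable (in fact finite). -/
theorem locally_monotone_off_countable (hS : IsOMinimalStructure S) {m n : ℕ}
    {U : Set (Fin m → ℝ)} {f : (Fin m → ℝ) → (Fin n → ℝ)} (hf : graphOver U f ∈ S (m + n))
    (l : (Fin n → ℝ) →ₗ[ℝ] ℝ) {a w : Fin m → ℝ}
    (hU : ∀ t ∈ Ioo (0 : ℝ) 1, a + t • w ∈ U) {D : Set ℝ} (hD : Ioo 0 1 ⊆ closure D)
    (hmono : ∀ t ∈ D, ∃ u ∈ 𝓝 t, MonotoneOn (fun s => l (f (a + s • w))) u) :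
    ∃ N : Set ℝ, N.Countable ∧ ∀ t ∈ Ioo (0 : ℝ) 1, t ∉ N →
      ∃ u ∈ 𝓝 t, MonotoneOn (fun s => l (f (a + s • w))) u := by
  set h : ℝ → ℝ := fun s => l (f (a + s • w)) with hh
  -- The graph of `h`, over the parameters whose point lies in `U`.
  have hH : {z : Fin 2 → ℝ | a + z 0 • w ∈ U ∧ z 1 = h (z 0)} ∈ S 2 := by
    let φ : Fin (m + n) → (Fin (2 + n) → ℝ) → ℝ := fun j v =>
      (Fin.append (a + v (Fin.castAdd n 0) • w) (fun i => v (Fin.natAdd 2 i)) : Fin (m + n) → ℝ) j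
    have hφ : ∀ j, IsPolynomialMap (φ j) := fun j => by
      refine Fin.addCases (fun j => ?_) (fun j => ?_) j
      · simp only [φ, Fin.append_left]
        exact (IsPolynomialMap.const _).add ((IsPolynomialMap.coord _).mul (IsPolynomialMap.const _))
      · simp only [φ, Fin.append_right]
        exact IsPolynomialMap.coord _
    have h1 := hS.preimage_mem hf hφ
    have h2 : {v : Fin (2 + n) → ℝ | v (Fin.castAdd n 1) - l (fun i => v (Fin.natAdd 2 i)) = 0} ∈
        S (2 + n) :=
      hS.zeroSet_mem ((IsPolynomialMap.coord _).sub ((IsPolynomialMap.linear l).comp_coord _))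
    convert hS.exists_append_mem (hS.inter_mem h1 h2) using 1
    ext z
    simp only [φ, mem_ofPred_eq, mem_inter_iff, Fin.append_left, Fin.append_right, sub_eq_zero]
    constructor
    · rintro ⟨hz, hz1⟩
      exact ⟨f (a + z 0 • w), ⟨_, hz, rfl⟩, hz1⟩
    · rintro ⟨y, ⟨x, hx, hxy⟩, hy⟩
      have hx1 : a + z 0 • w = x := funext fun j => by
        simpa using congrFun hxy (Fin.castAdd n j)
      have hx2 : y = f x := funext fun j => by
        simpa using congrFun hxy (Fin.natAdd m j)
      rw [hx1]
      refine ⟨hx, ?_⟩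
      rw [hh, hy, hx2, ← hx1]
  -- The pairs `(t, ε)` such that `h` decreases somewhere at distance less than `√ε` from `t`.
  let R : Set (Fin 2 → ℝ) := {z | ∃ s s' : ℝ, a + s • w ∈ U ∧ a + s' • w ∈ U ∧ s < s' ∧
    h s' < h s ∧ (s - z 0) * (s - z 0) < z 1 ∧ (s' - z 0) * (s' - z 0) < z 1}
  have hR : R ∈ S 2 := by
    have hc : ∀ i : Fin (2 + 4), IsPolynomialMap fun v : Fin (2 + 4) → ℝ => v i :=
      IsPolynomialMap.coord
    have hsq : ∀ i : Fin (2 + 4), {v : Fin (2 + 4) → ℝ |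
        0 < v 1 - (v i - v 0) * (v i - v 0)} ∈ S (2 + 4) := fun i =>
      hS.pos_mem ((hc 1).sub (((hc i).sub (hc 0)).mul ((hc i).sub (hc 0))))
    have h1 : {v : Fin (2 + 4) → ℝ | (fun j => v (![2, 4] j)) ∈
        {z : Fin 2 → ℝ | a + z 0 • w ∈ U ∧ z 1 = h (z 0)}} ∈ S (2 + 4) :=
      hS.preimage_mem hH fun j => hc _
    have h2 : {v : Fin (2 + 4) → ℝ | (fun j => v (![3, 5] j)) ∈
        {z : Fin 2 → ℝ | a + z 0 • w ∈ U ∧ z 1 = h (z 0)}} ∈ S (2 + 4) :=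
      hS.preimage_mem hH fun j => hc _
    have h3 := hS.pos_mem ((hc 3).sub (hc 2))
    have h4 := hS.pos_mem ((hc 4).sub (hc 5))
    -- The six coordinates are `t, ε, s, s', h s, h s'`.
    convert hS.image_castAdd_mem 4 (hS.inter_mem h1 (hS.inter_mem h2 (hS.inter_mem h3
      (hS.inter_mem h4 (hS.inter_mem (hsq 2) (hsq 3)))))) using 1
    ext z
    constructor
    · rintro ⟨s, s', hs, hs', hlt, hhlt, h5, h6⟩
      refine ⟨(![z 0, z 1, s, s', h s, h s'] : Fin 6 → ℝ), ⟨⟨hs, rfl⟩, ⟨hs', rfl⟩,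
        sub_pos.2 hlt, sub_pos.2 hhlt, sub_pos.2 h5, sub_pos.2 h6⟩, ?_⟩
      funext i
      fin_cases i <;> rfl
    · rintro ⟨v, ⟨⟨hs, hr⟩, ⟨hs', hr'⟩, h3, h4, h5, h6⟩, rfl⟩
      have hr : v 4 = h (v 2) := hr
      have hr' : v 5 = h (v 3) := hr'
      refine ⟨v 2, v 3, hs, hs', sub_pos.1 h3, ?_, sub_pos.1 h5, sub_pos.1 h6⟩
      rw [← hr, ← hr']
      exact sub_pos.1 h4
  -- The points of `(0, 1)` near which `h` is not monotone.
  let N : Set ℝ := {t | t ∈ Ioo (0 : ℝ) 1 ∧ ∀ ε : ℝ, 0 < ε → (![t, ε] : Fin 2 → ℝ) ∈ R}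
  have hN : {x : Fin 1 → ℝ | x 0 ∈ N} ∈ S 1 := by
    have hc : ∀ i : Fin 1, IsPolynomialMap fun v : Fin 1 → ℝ => v i := IsPolynomialMap.coord
    have h1 := hS.pos_mem (hc 0)
    have h2 := hS.pos_mem ((IsPolynomialMap.const 1).sub (hc 0))
    have h3 := hS.image_castAdd_mem (n := 1) 1 (hS.inter_mem (hS.compl_mem 2 R hR)
      (hS.pos_mem (IsPolynomialMap.coord (n := 2) 1)))
    convert hS.inter_mem h1 (hS.inter_mem h2 (hS.compl_mem 1 _ h3)) using 1
    ext x
    constructor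
    · rintro ⟨⟨hx0, hx1⟩, hx⟩
      refine ⟨hx0, sub_pos.2 hx1, ?_⟩
      rintro ⟨z, ⟨hz, hz1⟩, rfl⟩
      apply hz
      convert hx (z 1) hz1 using 1
      funext i
      fin_cases i <;> rfl
    · rintro ⟨hx0, hx1, hx⟩
      refine ⟨⟨hx0, sub_pos.1 hx1⟩, fun ε hε => ?_⟩
      by_contra hnot
      refine hx ⟨![x 0, ε], ⟨hnot, hε⟩, ?_⟩
      funext i
      fin_cases i
      rfl
  refine ⟨N, hS.countable_of_interior_eq_empty hN ?_, ?_⟩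
  · by_contra hne
    obtain ⟨t, ht⟩ := nonempty_iff_ne_empty.2 hne
    obtain ⟨r, hrN, hrD⟩ := mem_closure_iff_nhds.1 (hD (interior_subset ht).1) _
      (isOpen_interior.mem_nhds ht)
    obtain ⟨u, hu, hmu⟩ := hmono r hrD
    obtain ⟨δ, hδ, hball⟩ := Metric.mem_nhds_iff.1 hu
    obtain ⟨s, s', -, -, hlt, hhlt, hs, hs'⟩ := (interior_subset hrN).2 (δ ^ 2) (by positivity)
    have hin : ∀ y : ℝ, (y - r) * (y - r) < δ ^ 2 → y ∈ u := fun y hy => hball <| by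
      rw [Metric.mem_ball, Real.dist_eq]
      exact abs_lt_of_sq_lt_sq (by nlinarith) hδ.le
    exact absurd (hmu (hin s hs) (hin s' hs') hlt.le) (not_le.2 hhlt)
  · intro t ht htN
    have h1 : ∃ ε : ℝ, 0 < ε ∧ (![t, ε] : Fin 2 → ℝ) ∉ R := by
      by_contra! hcon
      exact htN ⟨ht, hcon⟩
    obtain ⟨ε, hε, hR'⟩ := h1
    have hcont : Continuous fun s : ℝ => (s - t) * (s - t) := by fun_prop
    have hu : {s : ℝ | (s - t) * (s - t) < ε} ∈ 𝓝 t :=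
      (isOpen_lt hcont continuous_const).mem_nhds (by simpa using hε)
    refine ⟨_, Filter.inter_mem hu (isOpen_Ioo.mem_nhds ht), ?_⟩
    rintro s ⟨hs, hsI⟩ s' ⟨hs', hsI'⟩ hss
    by_contra! hcon
    rcases hss.eq_or_lt with rfl | hlt
    · exact lt_irrefl _ hcon
    · exact hR' ⟨s, s', hU s hsI, hU s' hsI', hlt, hcon, hs, hs'⟩

end IsOMinimalStructure

/-! ### Analytic functions: zeros, hypersurfaces and local sections -/

/-- A nonzero germ has a nonvanishing iterated derivative along a single direction, so near `x` its
zeros are organized by a finite chain of directional derivatives. -/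
lemma AnalyticAt.exists_iteratedFDeriv_ne_zero {E : Type*} [NormedAddCommGroup E]
    [NormedSpace ℝ E] {g : E → ℝ} {x : E} (hg : AnalyticAt ℝ g x)
    (hne : ¬ ∀ᶠ y in 𝓝 x, g y = 0) :
    ∃ (u : E) (k : ℕ), iteratedFDeriv ℝ k g x (fun _ => u) ≠ 0 := by
  by_contra! hz
  apply hne
  obtain ⟨p, r, hp⟩ := hg
  have hball : Metric.eball x r ∈ 𝓝 x := Metric.eball_mem_nhds x hp.r_pos
  filter_upwards [hball] with y hy
  have hsum := hp.hasSum_sub hy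
  have hterm : ∀ n, p n (fun _ => y - x) = 0 := fun n => by
    have h1 := hp.factorial_smul (y - x) n
    rw [hz, nsmul_eq_mul, mul_eq_zero] at h1
    exact h1.resolve_left (Nat.cast_ne_zero.2 n.factorial_ne_zero)
  simp only [hterm] at hsum
  exact hsum.unique hasSum_zero

lemma fderiv_iteratedFDeriv_apply_const {E : Type*} [NormedAddCommGroup E]
    [NormedSpace ℝ E] {g : E → ℝ} {Ω : Set E} {x : E} (hg : AnalyticOnNhd ℝ g Ω) (hx : x ∈ Ω) (u : E)
    (k : ℕ) :
    fderiv ℝ (fun y => iteratedFDeriv ℝ k g y (fun _ => u)) x u =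
      iteratedFDeriv ℝ (k + 1) g x (fun _ => u) := by
  rw [iteratedFDeriv_succ_apply_left]
  have hd : DifferentiableAt ℝ (iteratedFDeriv ℝ k g) x :=
    (hg.iteratedFDeriv k x hx).differentiableAt
  have := hd.hasFDerivAt.continuousMultilinear_apply_const (fun _ => u)
  rw [this.fderiv]
  rfl

lemma analyticOnNhd_iteratedFDeriv_apply_const {E : Type*} [NormedAddCommGroup E]
    [NormedSpace ℝ E] {g : E → ℝ} {Ω : Set E} (hg : AnalyticOnNhd ℝ g Ω) (u : E) (k : ℕ) :
    AnalyticOnNhd ℝ (fun y => iteratedFDeriv ℝ k g y (fun _ => u)) Ω := fun x hx =>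
  (ContinuousMultilinearMap.apply ℝ (fun _ : Fin k => E) ℝ (fun _ => u)).analyticAt _ |>.comp
    ((hg.iteratedFDeriv k) x hx)

/-- The analytic implicit function theorem for a hypersurface `G = 0`, parametrized by the kernel of
the derivative of `G`. -/
lemma exists_analytic_parametrization {E : Type*} [NormedAddCommGroup E]
    [NormedSpace ℝ E] [FiniteDimensional ℝ E] {Ω : Set E} (hΩ : IsOpen Ω) {G : E → ℝ} {s u : E}
    (hs : s ∈ Ω) (hG : AnalyticAt ℝ G s) (h0 : G s = 0) (hu : fderiv ℝ G s u ≠ 0) :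
    ∃ (Ω' : Set (fderiv ℝ G s).ker) (ψ : (fderiv ℝ G s).ker → E),
      IsOpen Ω' ∧ AnalyticOnNhd ℝ ψ Ω' ∧ MapsTo ψ Ω' Ω ∧
        ∀ᶠ z in 𝓝 s, G z = 0 → ∃ w ∈ Ω', ψ w = z := by
  set L := fderiv ℝ G s with hL
  let P₀ : E →L[ℝ] E := ContinuousLinearMap.id ℝ E - (L u)⁻¹ • L.smulRight u
  have hP₀ : ∀ x, P₀ x = x - ((L u)⁻¹ * L x) • u := fun x => by simp [P₀, mul_smul]
  have hmem : ∀ x, P₀ x ∈ L.ker := fun x => by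
    rw [LinearMap.mem_ker, hP₀]
    simp only [ContinuousLinearMap.coe_coe, map_sub, map_smul, smul_eq_mul]
    field_simp
    simp
  let P : E →L[ℝ] L.ker := P₀.codRestrict L.ker hmem
  let inv : ℝ × L.ker →L[ℝ] E := (L.ker.subtypeL ∘L ContinuousLinearMap.snd ℝ ℝ L.ker) +
    (L u)⁻¹ • (ContinuousLinearMap.fst ℝ ℝ L.ker).smulRight u
  let e : E ≃L[ℝ] ℝ × L.ker := ContinuousLinearEquiv.equivOfInverse (L.prod P) inv
    (fun x => by simp [inv, P, hP₀, mul_smul])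
    (fun ⟨r, w, hw⟩ => by
      have hw' : L w = 0 := hw
      ext
      · simp only [ContinuousLinearMap.prod_apply, inv]
        simp [hw']
        field_simp
      · simp [inv, P, hP₀, hw', inv_mul_cancel₀ hu])
  let Θ : E → ℝ × L.ker := fun x => (G x, P x)
  have hΘ : ContDiffAt ℝ ω Θ s := hG.contDiffAt.prodMk P.contDiff.contDiffAt
  have hΘ' : HasFDerivAt Θ (e : E →L[ℝ] ℝ × L.ker) s :=
    hG.differentiableAt.hasFDerivAt.prodMk P.hasFDerivAt
  set Ψ := hΘ.localInverse hΘ' (by simp) with hΨ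
  have hΨa : AnalyticAt ℝ Ψ (Θ s) := (hΘ.to_localInverse hΘ' (by simp)).analyticAt
  have hleft : ∀ᶠ z in 𝓝 s, Ψ (Θ z) = z :=
    (hΘ.hasStrictFDerivAt' hΘ' (by simp)).eventually_left_inverse
  let ψ : L.ker → E := fun w => Ψ (0, w)
  have hΘs : Θ s = (0, P s) := by simp [Θ, h0]
  have hψa : AnalyticAt ℝ ψ (P s) := by
    have h1 : AnalyticAt ℝ (fun w : L.ker => ((0 : ℝ), w)) (P s) :=
      analyticAt_const.prod analyticAt_id
    exact AnalyticAt.comp (g := Ψ) (by rw [← hΘs]; exact hΨa) h1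
  have hψs : ψ (P s) = s := by
    change Ψ (0, P s) = s
    rw [← hΘs]; exact hleft.self_of_nhds
  let Ω' : Set L.ker := {w | AnalyticAt ℝ ψ w} ∩ ψ ⁻¹' Ω
  have hΩ' : IsOpen Ω' := by
    refine ContinuousOn.isOpen_inter_preimage (fun w hw => ?_) (isOpen_analyticAt ℝ ψ) hΩ
    exact (AnalyticAt.continuousAt hw).continuousWithinAt
  refine ⟨Ω', ψ, hΩ', fun w hw => hw.1, fun w hw => hw.2, ?_⟩
  have hPs : P s ∈ Ω' := ⟨hψa, by change ψ (P s) ∈ Ω; rwa [hψs]⟩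
  filter_upwards [hleft, P.continuous.continuousAt.preimage_mem_nhds (hΩ'.mem_nhds hPs)]
    with z hz hPz hGz
  refine ⟨P z, hPz, ?_⟩
  change Ψ (0, P z) = z
  rw [← hGz]; exact hz

/-- If `F ∘ τ = η` near `z` and `z` is not a critical point of `τ`, then `F` is `η` composed with a
local section of `τ`. -/
lemma AnalyticAt.contDiffAt_of_comp_eq {E H : Type*} [NormedAddCommGroup E]
    [NormedSpace ℝ E] [NormedAddCommGroup H] [NormedSpace ℝ H] [CompleteSpace H]
    {τ : E → ℝ} {η : E → H} {F : ℝ → H} {z u : E} (hτ : AnalyticAt ℝ τ z)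
    (hη : AnalyticAt ℝ η z) (hF : ∀ᶠ y in 𝓝 z, F (τ y) = η y) (hu : fderiv ℝ τ z u ≠ 0) :
    ContDiffAt ℝ 1 F (τ z) := by
  have hline : AnalyticAt ℝ (fun r : ℝ => z + r • u) 0 := by fun_prop
  have hz : z + (0 : ℝ) • u = z := by simp
  let q : ℝ → ℝ := fun r => τ (z + r • u)
  have hq0 : q 0 = τ z := by simp [q]
  have hq : AnalyticAt ℝ q 0 := AnalyticAt.comp (g := τ) (by rwa [hz]) hline
  have hqd : HasDerivAt q (fderiv ℝ τ z u) 0 := by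
    have h1 : HasDerivAt (fun r : ℝ => z + r • u) u 0 := by
      simpa using ((hasDerivAt_id (0 : ℝ)).smul_const u).const_add z
    have h2 : HasFDerivAt τ (fderiv ℝ τ z) (z + (0 : ℝ) • u) := by
      rw [hz]; exact hτ.differentiableAt.hasFDerivAt
    exact h2.comp_hasDerivAt 0 h1
  have hqs : HasStrictDerivAt q (fderiv ℝ τ z u) 0 := by
    have := hq.hasStrictDerivAt
    rwa [hqd.deriv] at this
  set ρ := hqs.localInverse q _ 0 hu with hρ
  have hright : ∀ᶠ t in 𝓝 (q 0), q (ρ t) = t :=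
    (hqs.hasStrictFDerivAt_equiv hu).eventually_right_inverse
  have hρ0 : ρ (q 0) = 0 :=
    HasStrictFDerivAt.localInverse_apply_image (hqs.hasStrictFDerivAt_equiv hu)
  have hρa : ContDiffAt ℝ 1 ρ (q 0) := by
    have h1 : HasFDerivAt q
        ((ContinuousLinearEquiv.unitsEquivAut ℝ (Units.mk0 _ hu) : ℝ ≃L[ℝ] ℝ) : ℝ →L[ℝ] ℝ) 0 :=
      (hqs.hasStrictFDerivAt_equiv hu).hasFDerivAt
    exact ContDiffAt.to_localInverse (hq.contDiffAt (n := 1)) h1 one_ne_zero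
  rw [← hq0]
  have hcont : Tendsto (fun t => z + ρ t • u) (𝓝 (q 0)) (𝓝 z) := by
    have h1 : ContinuousAt (fun t => z + ρ t • u) (q 0) :=
      continuousAt_const.add (hρa.continuousAt.smul continuousAt_const)
    rw [ContinuousAt, hρ0, hz] at h1
    exact h1
  have hFeq : F =ᶠ[𝓝 (q 0)] fun t => η (z + ρ t • u) := by
    filter_upwards [hright, hcont.eventually hF] with t ht h2
    rw [← h2]
    congr 1
    exact ht.symm
  refine ContDiffAt.congr_of_eventuallyEq ?_ hFeq
  refine ContDiffAt.comp (g := η) (q 0) ?_ (contDiffAt_const.add (hρa.smul contDiffAt_const))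
  rw [hρ0, hz]
  exact hη.contDiffAt

lemma countable_inter_image_of_locally {E : Type*} [TopologicalSpace E]
    [SecondCountableTopology E] {τ : E → ℝ} {T : Set ℝ} {A : Set E}
    (h : ∀ s ∈ A, ∃ O ∈ 𝓝 s, (T ∩ τ '' (A ∩ O)).Countable) : (T ∩ τ '' A).Countable := by
  choose! O hO hc using h
  obtain ⟨t, htA, htc, hcov⟩ := TopologicalSpace.countable_cover_nhdsWithin
    (s := A) (f := O) fun x hx => mem_nhdsWithin_of_mem_nhds (hO x hx)
  refine (htc.biUnion fun x hx => hc x (htA hx)).mono ?_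
  rintro _ ⟨hT, z, hz, rfl⟩
  obtain ⟨x, hx, hzx⟩ := mem_iUnion₂.1 (hcov hz)
  exact mem_iUnion₂.2 ⟨x, hx, hT, z, ⟨hz, hzx⟩, rfl⟩

/-! ### Countable decomposition of semianalytic sets -/

/-- A set `S` is called negligible here when `A ∩ S` contributes only countably many values of `τ` in
`T`. By `hsurf`, regular parts of analytic hypersurfaces are negligible. If the `k`-th derivative of
`g` along `u` is nonzero at `s`, then near `s` the zeros of the `m`-th one are negligible for each
`m ≤ k`: at such a zero, one of the derivatives of orders `m, …, k - 1` vanishes while the next one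
does not. -/
lemma exists_negligible_or_iteratedFDeriv_ne_zero {E : Type*} [NormedAddCommGroup E]
    [NormedSpace ℝ E] {Ω A : Set E} {τ : E → ℝ} {T : Set ℝ} (hΩ : IsOpen Ω)
    (hsurf : ∀ (G : E → ℝ) (u : E), AnalyticOnNhd ℝ G Ω →
      (T ∩ τ '' {z ∈ A | z ∈ Ω ∧ G z = 0 ∧ fderiv ℝ G z u ≠ 0}).Countable)
    {g : E → ℝ} (hg : AnalyticOnNhd ℝ g Ω) {s : E} (hs : s ∈ Ω) {u : E} {m k : ℕ} (hmk : m ≤ k)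
    (hne : iteratedFDeriv ℝ k g s (fun _ => u) ≠ 0) :
    ∃ O ∈ 𝓝 s, ∃ S : Set E, (T ∩ τ '' (A ∩ S)).Countable ∧
      ∀ x ∈ O, x ∈ S ∨ iteratedFDeriv ℝ m g x (fun _ => u) ≠ 0 := by
  let D : ℕ → E → ℝ := fun j x => iteratedFDeriv ℝ j g x (fun _ => u)
  have hD : ∀ j, AnalyticOnNhd ℝ (D j) Ω := analyticOnNhd_iteratedFDeriv_apply_const hg u
  have hD' : ∀ j, ∀ x ∈ Ω, fderiv ℝ (D j) x u = D (j + 1) x := fun j x hx =>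
    fderiv_iteratedFDeriv_apply_const hg hx u j
  refine ⟨Ω ∩ {x | D k x ≠ 0}, inter_mem (hΩ.mem_nhds hs)
    ((hD k s hs).continuousAt.eventually_ne hne),
    ⋃ j, {z | z ∈ Ω ∧ D j z = 0 ∧ fderiv ℝ (D j) z u ≠ 0}, ?_, ?_⟩
  · rw [inter_iUnion, image_iUnion, inter_iUnion]
    exact countable_iUnion fun j => hsurf (D j) u (hD j)
  · rintro x ⟨hxΩ, hxk⟩
    by_contra! hcon
    obtain ⟨h1, h2⟩ := hcon
    have h3 : ∀ j, m ≤ j → D j x = 0 := by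
      intro j hj
      induction j, hj using Nat.le_induction with
      | base => exact h2
      | succ j hj ih =>
        by_contra h4
        exact h1 (mem_iUnion.2 ⟨j, hxΩ, ih, by rwa [hD' j x hxΩ]⟩)
    exact hxk (h3 k hmk)

/-- Let `A` be given in `Ω` by sign conditions on finitely many analytic functions, and suppose
`F ∘ τ = η` on `A` with `τ`, `η` analytic. Then `F` fails to be `C¹` at only countably many values
taken by `τ` on `A ∩ Ω`. The proof is by induction on the dimension: away from regular parts of
hypersurfaces, `A` is open and `τ` is either locally constant or submersive; on a hypersurface one
pulls everything back by an analytic parametrization. -/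
theorem countable_not_contDiffAt_of_comp_eq {ι H : Type*} [Finite ι] [NormedAddCommGroup H]
    [NormedSpace ℝ H] [CompleteSpace H] {F : ℝ → H} (d : ℕ) :
    ∀ {E : Type} [NormedAddCommGroup E] [NormedSpace ℝ E] [FiniteDimensional ℝ E],
      Module.finrank ℝ E = d → ∀ {Ω A : Set E} {g : ι → E → ℝ} {τ : E → ℝ} {η : E → H},
      IsOpen Ω → (∀ i, AnalyticOnNhd ℝ (g i) Ω) → AnalyticOnNhd ℝ τ Ω → AnalyticOnNhd ℝ η Ω →
      (∀ x ∈ Ω, ∀ y ∈ Ω, (∀ i, SignType.sign (g i x) = SignType.sign (g i y)) → x ∈ A → y ∈ A) →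
      (∀ z ∈ A, z ∈ Ω → F (τ z) = η z) →
      ({t | ¬ ContDiffAt ℝ 1 F t} ∩ τ '' (A ∩ Ω)).Countable := by
  induction d using Nat.strong_induction_on with
  | _ d ih =>
  intro E _ _ _ hd Ω A g τ η hΩ hg hτ hη hA hF
  set T : Set ℝ := {t | ¬ ContDiffAt ℝ 1 F t} with hT
  -- Induction hypothesis, transported to the regular part of the hypersurface `G = 0`.
  have hsurf : ∀ (G : E → ℝ) (u : E), AnalyticOnNhd ℝ G Ω →
      (T ∩ τ '' {z ∈ A | z ∈ Ω ∧ G z = 0 ∧ fderiv ℝ G z u ≠ 0}).Countable := by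
    intro G u hG
    refine countable_inter_image_of_locally fun s hs => ?_
    obtain ⟨hsA, hsΩ, hs0, hsu⟩ := hs
    obtain ⟨Ω', ψ, hΩ', hψ, hmaps, hev⟩ :=
      exists_analytic_parametrization hΩ hsΩ (hG s hsΩ) hs0 hsu
    refine ⟨_, hev, ?_⟩
    have hlt : Module.finrank ℝ (fderiv ℝ G s).ker < d := by
      rw [← hd]
      refine Submodule.finrank_lt fun htop => hsu ?_
      have : u ∈ (fderiv ℝ G s).ker := by rw [htop]; trivial
      exact this
    refine (ih _ hlt rfl (Ω := Ω') (A := ψ ⁻¹' A) (g := fun i => g i ∘ ψ) (τ := τ ∘ ψ)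
      (η := η ∘ ψ) hΩ' (fun i => (hg i).comp hψ hmaps) (hτ.comp hψ hmaps) (hη.comp hψ hmaps)
      (fun x hx y hy hxy => hA _ (hmaps hx) _ (hmaps hy) hxy)
      (fun z hz hzΩ => hF _ hz (hmaps hzΩ))).mono ?_
    rintro _ ⟨hzT, z, ⟨⟨hzA, hzΩ, hz0, -⟩, hz⟩, rfl⟩
    obtain ⟨w, hw, rfl⟩ := hz hz0
    exact ⟨hzT, w, ⟨hzA, hw⟩, rfl⟩
  refine countable_inter_image_of_locally fun s hs => ?_
  obtain ⟨hsA, hsΩ⟩ := hs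
  have hgood : ∀ i, ∃ O ∈ 𝓝 s, ∃ S : Set E, (T ∩ τ '' (A ∩ S)).Countable ∧
      ∀ x ∈ O, x ∈ S ∨ ∀ᶠ y in 𝓝 x, SignType.sign (g i x) = SignType.sign (g i y) := by
    intro i
    by_cases hz : ∀ᶠ y in 𝓝 s, g i y = 0
    · obtain ⟨O, hO, hOo, hsO⟩ := eventually_nhds_iff.1 hz
      refine ⟨O, hOo.mem_nhds hsO, ∅, by simp, fun x hx => Or.inr ?_⟩
      filter_upwards [hOo.mem_nhds hx] with y hy
      rw [hO x hx, hO y hy]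
    · obtain ⟨u, k, hk⟩ := (hg i s hsΩ).exists_iteratedFDeriv_ne_zero hz
      obtain ⟨O, hO, S, hS, hOS⟩ :=
        exists_negligible_or_iteratedFDeriv_ne_zero hΩ hsurf (hg i) hsΩ k.zero_le hk
      refine ⟨O ∩ Ω, inter_mem hO (hΩ.mem_nhds hsΩ), S, hS, fun x hx => (hOS x hx.1).imp_right ?_⟩
      intro hne
      rw [iteratedFDeriv_zero_apply] at hne
      have hc := (hg i x hx.2).continuousAt
      rcases lt_or_gt_of_ne hne with h | h
      · filter_upwards [hc.eventually_lt_const h] with y hy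
        rw [sign_neg h, sign_neg hy]
      · filter_upwards [hc.eventually_const_lt h] with y hy
        rw [sign_pos h, sign_pos hy]
  choose O hO S hS hOS using hgood
  -- The derivative of order zero of `τ - τ s` is left out (`1 ≤ k`): only critical points of `τ` have
  -- to be negligible.
  obtain ⟨O', hO', S', hS', hOS'⟩ : ∃ O ∈ 𝓝 s, ∃ S : Set E, (T ∩ τ '' (A ∩ S)).Countable ∧
      ∀ x ∈ O, x ∈ S ∨ ∃ u, fderiv ℝ τ x u ≠ 0 := by
    by_cases hz : ∀ᶠ y in 𝓝 s, τ y - τ s = 0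
    · refine ⟨_, hz, {y | τ y - τ s = 0}, ?_, fun x hx => Or.inl hx⟩
      refine (countable_singleton (τ s)).mono ?_
      rintro _ ⟨-, z, ⟨-, hz⟩, rfl⟩
      exact sub_eq_zero.1 hz
    · have hτ' : AnalyticOnNhd ℝ (fun y => τ y - τ s) Ω := hτ.sub analyticOnNhd_const
      obtain ⟨u, k, hk⟩ := (hτ' s hsΩ).exists_iteratedFDeriv_ne_zero hz
      have hk1 : 1 ≤ k := by
        rcases Nat.eq_zero_or_pos k with rfl | h
        · simp at hk
        · exact h
      obtain ⟨O, hO, S, hS, hOS⟩ :=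
        exists_negligible_or_iteratedFDeriv_ne_zero hΩ hsurf hτ' hsΩ hk1 hk
      refine ⟨O, hO, S, hS, fun x hx => (hOS x hx).imp_right fun hne => ⟨u, ?_⟩⟩
      rw [iteratedFDeriv_one_apply, fderiv_sub_const] at hne
      exact hne
  refine ⟨Ω ∩ ((⋂ i, O i) ∩ O'),
    inter_mem (hΩ.mem_nhds hsΩ) (inter_mem (iInter_mem.2 hO) hO'), ?_⟩
  refine ((countable_iUnion hS).union hS').mono ?_
  rintro _ ⟨hzT, z, ⟨⟨hzA, hzΩ⟩, -, hzO, hzO'⟩, rfl⟩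
  rw [mem_iInter] at hzO
  by_cases hzS : ∃ i, z ∈ S i
  · obtain ⟨i, hi⟩ := hzS
    exact Or.inl (mem_iUnion.2 ⟨i, hzT, z, ⟨hzA, hi⟩, rfl⟩)
  push Not at hzS
  rcases hOS' z hzO' with h | ⟨u, hu⟩
  · exact Or.inr ⟨hzT, z, ⟨hzA, h⟩, rfl⟩
  -- Here `z` is interior to `A` and not critical for `τ`.
  exfalso
  apply hzT
  refine (hτ z hzΩ).contDiffAt_of_comp_eq (hη z hzΩ) ?_ hu
  have h1 : ∀ᶠ y in 𝓝 z, ∀ i, SignType.sign (g i z) = SignType.sign (g i y) :=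
    eventually_all.2 fun i => (hOS i z (hzO i)).resolve_left (hzS i)
  filter_upwards [h1, hΩ.mem_nhds hzΩ] with y hy hyΩ
  exact hF y (hA z hzΩ y hyΩ hy hzA) hyΩ

/-! ### Subanalytic maps along lines -/

/-- Membership in a finite Boolean combination depends only on the signs of finitely many of the
functions involved. -/
lemma exists_finite_sign_determined {E : Type*} {P : (E → ℝ) → Prop} {A : Set E}
    (hA : A ∈ BooleanSubalgebra.closure
      {A : Set E | ∃ g : E → ℝ, P g ∧ (A = {y | g y = 0} ∨ A = {y | 0 < g y})}) :
    ∃ G : Set (E → ℝ), G.Finite ∧ (∀ g ∈ G, P g) ∧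
      ∀ x y, (∀ g ∈ G, SignType.sign (g x) = SignType.sign (g y)) → x ∈ A → y ∈ A := by
  induction hA using BooleanSubalgebra.closure_bot_sup_induction with
  | mem A hA =>
    obtain ⟨g, hg, hA⟩ := hA
    refine ⟨{g}, finite_singleton g, by simpa using hg, fun x y hxy hx => ?_⟩
    have hxy : SignType.sign (g x) = SignType.sign (g y) := hxy g rfl
    rcases hA with rfl | rfl
    · have hx : g x = 0 := hx
      rw [hx, sign_zero] at hxy
      exact sign_eq_zero_iff.1 hxy.symm
    · have hx : 0 < g x := hx
      rw [sign_pos hx] at hxy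
      exact sign_eq_one_iff.1 hxy.symm
  | bot => exact ⟨∅, finite_empty, by simp, fun x y _ hx => hx⟩
  | sup A hA B hB ihA ihB =>
    obtain ⟨G, hG, hPG, hGA⟩ := ihA
    obtain ⟨G', hG', hPG', hGB⟩ := ihB
    refine ⟨G ∪ G', hG.union hG', fun g hg => hg.elim (hPG g) (hPG' g), fun x y hxy hx => ?_⟩
    rcases hx with hx | hx
    · exact Or.inl (hGA x y (fun g hg => hxy g (Or.inl hg)) hx)
    · exact Or.inr (hGB x y (fun g hg => hxy g (Or.inr hg)) hx)
  | compl A hA ihA =>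
    obtain ⟨G, hG, hPG, hGA⟩ := ihA
    exact ⟨G, hG, hPG, fun x y hxy hx hy => hx (hGA y x (fun g hg => (hxy g hg).symm) hy)⟩

/-- A continuous map with subanalytic graph is `C¹` along any line, outside countably many
parameters. Locally the graph is the projection of a semianalytic set `Y`; on the part of `Y` above
the line, the parameter `τ` and the value `η` of the map are both restrictions of affine maps. -/
theorem IsSubanalytic.countable_setOf_not_contDiffAt {m n : ℕ} {U : Set (Fin m → ℝ)}
    {f : (Fin m → ℝ) → (Fin n → ℝ)} (hf : IsSubanalytic (graphOver U f)) (hfc : ContinuousOn f U)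
    {a w : Fin m → ℝ} (hw : w ≠ 0) {I : Set ℝ} (hI : IsOpen I) (hIU : ∀ t ∈ I, a + t • w ∈ U) :
    {t ∈ I | ¬ ContDiffAt ℝ 1 (fun s : ℝ => f (a + s • w)) t}.Countable := by
  obtain ⟨i, hi⟩ := Function.ne_iff.1 hw
  have hi : w i ≠ 0 := hi
  set F : ℝ → Fin n → ℝ := fun s => f (a + s • w) with hF
  set T : Set ℝ := {t | ¬ ContDiffAt ℝ 1 F t} with hT
  suffices h : (T ∩ id '' I).Countable by
    refine h.mono ?_
    rintro t ⟨htI, ht⟩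
    exact ⟨ht, t, htI, rfl⟩
  refine countable_inter_image_of_locally fun t₀ ht₀ => ?_
  obtain ⟨V, hV, htV, k, Y, -, hY, hYV⟩ := hf (Fin.append (a + t₀ • w) (F t₀))
  have hFc : ContinuousOn F I :=
    hfc.comp (by fun_prop) hIU
  have hγ : ContinuousAt (fun t : ℝ => (Fin.append (a + t • w) (F t) : Fin (m + n) → ℝ)) t₀ := by
    rw [continuousAt_pi]
    have hFt := hFc.continuousAt (hI.mem_nhds ht₀)
    intro j
    refine Fin.addCases (fun j => ?_) (fun j => ?_) j
    · simp only [Fin.append_left]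
      fun_prop
    · simp only [Fin.append_right]
      exact (continuous_apply j).continuousAt.comp hFt
  refine ⟨_, hγ.preimage_mem_nhds (hV.mem_nhds htV), ?_⟩
  let p : (Fin (m + n + k) → ℝ) → Fin m → ℝ := fun y j => y (Fin.castAdd k (Fin.castAdd n j))
  let η : (Fin (m + n + k) → ℝ) → Fin n → ℝ := fun y j => y (Fin.castAdd k (Fin.natAdd m j))
  let τ : (Fin (m + n + k) → ℝ) → ℝ := fun y => (p y i - a i) / w i
  have hpη : ∀ y ∈ Y, η y = f (p y) := fun y hy => by
    have h1 : (fun j : Fin (m + n) => y (Fin.castAdd k j)) ∈ graphOver U f ∩ V := by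
      rw [hYV]; exact ⟨y, hy, rfl⟩
    obtain ⟨⟨x, -, hx⟩, -⟩ := h1
    have h2 : p y = x := funext fun j => by
      have := congrFun hx (Fin.castAdd n j)
      simpa using this
    have h3 : η y = f x := funext fun j => by
      have := congrFun hx (Fin.natAdd m j)
      simpa using this
    rw [h2, h3]
  have hcoord : ∀ (j : Fin (m + n + k)) (Ω : Set (Fin (m + n + k) → ℝ)),
      AnalyticOnNhd ℝ (fun y : Fin (m + n + k) → ℝ => y j) Ω := fun j Ω =>
    (ContinuousLinearMap.proj (R := ℝ) (φ := fun _ => ℝ) j).analyticOnNhd Ω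
  have hτ : ∀ Ω, AnalyticOnNhd ℝ τ Ω := fun Ω =>
    ((hcoord _ Ω).sub analyticOnNhd_const).div analyticOnNhd_const fun _ _ => hi
  have hη : ∀ Ω, AnalyticOnNhd ℝ η Ω := fun Ω =>
    AnalyticOnNhd.pi fun j => hcoord _ Ω
  -- The part of `Y` above the line `a + ℝ w`.
  let A : Set (Fin (m + n + k) → ℝ) := {y | y ∈ Y ∧ p y = a + τ y • w}
  have hmain : (T ∩ τ '' A).Countable := by
    refine countable_inter_image_of_locally fun y hy => ?_
    obtain ⟨Ω, hΩ, hyΩ, C, hC, hYC⟩ := hY y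
    refine ⟨Ω, hΩ.mem_nhds hyΩ, ?_⟩
    obtain ⟨G, hGf, hGa, hGC⟩ := exists_finite_sign_determined hC
    have : Finite G := hGf
    refine countable_not_contDiffAt_of_comp_eq (ι := G ⊕ Fin m) (F := F) _ rfl
      (g := Sum.elim (fun g => g.1) (fun j y => p y j - (a j + τ y * w j))) (η := η) hΩ ?_
      (hτ Ω) (hη Ω) ?_ ?_
    · rintro (g | j)
      · exact hGa g.1 g.2
      · exact (hcoord _ Ω).sub (analyticOnNhd_const.add ((hτ Ω).mul analyticOnNhd_const))
    · rintro x hx z hz hxz ⟨hxY, hxp⟩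
      have h1 : x ∈ C := (hYC ▸ (⟨hxY, hx⟩ : x ∈ Y ∩ Ω) : x ∈ C ∩ Ω).1
      have h2 : z ∈ C := hGC x z (fun g hg => hxz (Sum.inl ⟨g, hg⟩)) h1
      refine ⟨(hYC ▸ (⟨h2, hz⟩ : z ∈ C ∩ Ω) : z ∈ Y ∩ Ω).1, funext fun j => ?_⟩
      have h3 := hxz (Sum.inr j)
      have h4 : p x j - (a j + τ x * w j) = 0 := by
        rw [hxp]; simp
      simp only [Sum.elim_inr, h4, sign_zero] at h3
      have h5 := sign_eq_zero_iff.1 h3.symm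
      simpa using sub_eq_zero.1 h5
    · rintro z ⟨hzY, hzp⟩ -
      rw [hpη z hzY, hzp]
  refine hmain.mono ?_
  rintro _ ⟨htT, t, ⟨htI, htV'⟩, rfl⟩
  have h1 : (Fin.append (a + t • w) (F t) : Fin (m + n) → ℝ) ∈ graphOver U f ∩ V :=
    ⟨⟨a + t • w, hIU t htI, rfl⟩, htV'⟩
  rw [hYV] at h1
  obtain ⟨y, hyY, hy⟩ := h1
  have hp : p y = a + t • w := funext fun j => by
    have := congrFun hy (Fin.castAdd n j)
    simpa using this
  have hτy : τ y = t := by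
    simp only [τ, hp]
    simp [hi]
  exact ⟨htT, y, ⟨hyY, by rw [hτy, hp]⟩, hτy⟩

lemma ContDiffAt.exists_monotoneOn_of_dense {h : ℝ → ℝ} {t : ℝ} (ht : ContDiffAt ℝ 1 h t)
    {D : Set ℝ} (hD : ∀ᶠ s in 𝓝 t, s ∈ closure D) (hder : ∀ s ∈ D, 0 ≤ deriv h s) :
    ∃ u ∈ 𝓝 t, MonotoneOn h u := by
  have h1 : ∀ᶠ s in 𝓝 t, ContDiffAt ℝ 1 h s := ht.eventually (by simp)
  obtain ⟨δ, hδ, hball⟩ := Metric.eventually_nhds_iff_ball.1 (h1.and hD)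
  have hcd : ContDiffOn ℝ 1 h (Metric.ball t δ) := fun s hs => (hball s hs).1.contDiffWithinAt
  have hcont := hcd.continuousOn_deriv_of_isOpen Metric.isOpen_ball le_rfl
  refine ⟨_, Metric.ball_mem_nhds t hδ, monotoneOn_of_deriv_nonneg (convex_ball t δ)
    hcd.continuousOn ?_ ?_⟩
  · rw [Metric.isOpen_ball.interior_eq]
    exact hcd.differentiableOn one_ne_zero
  · rw [Metric.isOpen_ball.interior_eq]
    intro s hs
    by_contra! hneg
    have h2 := (hcont.continuousAt (Metric.isOpen_ball.mem_nhds hs)).eventually_lt_const hneg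
    obtain ⟨r, hr, hrD⟩ := mem_closure_iff_nhds.1 (hball s hs).2 _ h2
    exact absurd (hder r hrD) (not_le.2 hr)

/-! ### Coincidence pairs and injectivity -/

/-- The only consequence of tameness that is needed: along a segment, a linear functional of `f`
whose derivative is nonnegative on a dense set is locally monotone off a countable set. This excludes
behaviour such as that of the negative of the Cantor function. -/
theorem IsTameOn.locally_monotone_off_countable {m n : ℕ} {U : Set (Fin m → ℝ)}
    {f : (Fin m → ℝ) → (Fin n → ℝ)} (hf : IsTameOn f U) (hfc : ContinuousOn f U)
    (l : (Fin n → ℝ) →ₗ[ℝ] ℝ) {a w : Fin m → ℝ} (hw : w ≠ 0)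
    (hU : ∀ t ∈ Ioo (0 : ℝ) 1, a + t • w ∈ U) {D : Set ℝ} (hD : Ioo 0 1 ⊆ closure D)
    (hDI : D ⊆ Ioo 0 1) (hC1 : ∀ t ∈ D, ContDiffAt ℝ 1 (fun s : ℝ => f (a + s • w)) t)
    (hder : ∀ t ∈ D, 0 ≤ deriv (fun s : ℝ => l (f (a + s • w))) t) :
    ∃ N : Set ℝ, N.Countable ∧ ∀ t ∈ Ioo (0 : ℝ) 1, t ∉ N →
      ∃ u ∈ 𝓝 t, MonotoneOn (fun s => l (f (a + s • w))) u := by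
  have hmono : ∀ t ∈ Ioo (0 : ℝ) 1, ContDiffAt ℝ 1 (fun s : ℝ => f (a + s • w)) t →
      ∃ u ∈ 𝓝 t, MonotoneOn (fun s => l (f (a + s • w))) u := fun t ht hct =>
    ContDiffAt.exists_monotoneOn_of_dense
      ((LinearMap.toContinuousLinearMap l).contDiff.contDiffAt.comp t hct)
      (eventually_of_mem (isOpen_Ioo.mem_nhds ht) fun s hs => hD hs) hder
  rcases hf with ⟨S, hS, hfS⟩ | hf
  · exact hS.locally_monotone_off_countable hfS l hU hD fun t ht => hmono t (hDI ht) (hC1 t ht)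
  · refine ⟨_, hf.countable_setOf_not_contDiffAt hfc hw isOpen_Ioo hU, fun t ht htN => ?_⟩
    refine hmono t ht ?_
    by_contra hcon
    exact htN ⟨ht, hcon⟩

lemma jacobiMatrix_mulVec {n : ℕ} (f : (Fin n → ℝ) → (Fin n → ℝ)) (x v : Fin n → ℝ) :
    (jacobiMatrix f x).mulVec v = fderiv ℝ f x v := by
  rw [jacobiMatrix, LinearMap.toMatrix'_mulVec]
  rfl

/-- A coincidence `f a = f b` with `a` off `B` can be moved to one with both points off `B`: `f` is
open at `a`, hence takes near `a` the values it has at points near `b`. -/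
lemma exists_ne_eq_of_mem_diff {n : ℕ} {U B : Set (Fin n → ℝ)} {f : (Fin n → ℝ) → (Fin n → ℝ)}
    (hUo : IsOpen U) (hfc : ContinuousOn f U) (hW : IsOpen (U \ B)) (hBnd : IsNowhereDense B)
    (hC1 : ContDiffOn ℝ 1 f (U \ B)) (himm : ∀ x ∈ U \ B, (jacobiMatrix f x).det ≠ 0)
    {a b : Fin n → ℝ} (ha : a ∈ U \ B) (hb : b ∈ U) (hab : a ≠ b) (hfab : f a = f b) :
    ∃ a' ∈ U \ B, ∃ b' ∈ U \ B, a' ≠ b' ∧ f a' = f b' := by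
  obtain ⟨Na, Nb, hNa, hNb, haN, hbN, hdisj⟩ := t2_separation hab
  have hstrict := (hC1.contDiffAt (hW.mem_nhds ha)).hasStrictFDerivAt one_ne_zero
  have hsurj : (fderiv ℝ f a).range = ⊤ := by
    rw [LinearMap.range_eq_top]
    refine LinearMap.injective_iff_surjective.1 ?_
    refine (injective_iff_map_eq_zero _).2 fun v hv => ?_
    refine Matrix.eq_zero_of_mulVec_eq_zero (himm a ha) ?_
    rw [jacobiMatrix_mulVec]
    exact hv
  have hmap := hstrict.map_nhds_eq_of_surj hsurj
  have h1 : f '' (Na ∩ (U \ B)) ∈ 𝓝 (f b) := by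
    rw [← hfab, ← hmap]
    exact image_mem_map (inter_mem (hNa.mem_nhds haN) (hW.mem_nhds ha))
  have h2 : Nb ∩ U ∩ f ⁻¹' (f '' (Na ∩ (U \ B))) ∈ 𝓝 b :=
    inter_mem (inter_mem (hNb.mem_nhds hbN) (hUo.mem_nhds hb))
      ((hfc.continuousAt (hUo.mem_nhds hb)).preimage_mem_nhds h1)
  have hdense : Dense (closure B)ᶜ := interior_eq_empty_iff_dense_compl.1 hBnd
  obtain ⟨b', ⟨⟨hb'N, hb'U⟩, a', ⟨ha'N, ha'⟩, hfa'⟩, hb'B⟩ :=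
    mem_closure_iff_nhds.1 (hdense b) _ h2
  refine ⟨a', ha', b', ⟨hb'U, fun h => hb'B (subset_closure h)⟩, ?_, hfa'⟩
  rintro rfl
  exact disjoint_left.1 hdisj ha'N hb'N

/-- A coincidence `f a = f b` off `B` can be moved so that the segment joining the two points meets
`B` in a nowhere dense set of parameters. On the locally compact set `M` of coincident pairs, the map
sending a pair to the point at parameter `t` of its segment is open, because
`t • df a + (1 - t) • df b` is nonsingular. So a generic pair in `M` will do, by the Baire category
theorem. -/
lemma exists_segment_dense_diff {n : ℕ} {U B : Set (Fin n → ℝ)}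
    {f : (Fin n → ℝ) → (Fin n → ℝ)} (hUc : Convex ℝ U) (hW : IsOpen (U \ B))
    (hBnd : IsNowhereDense B) (hC1 : ContDiffOn ℝ 1 f (U \ B))
    (hCr : ∀ A ∈ convexHull ℝ (jacobiMatrix f '' (U \ B)), A.det ≠ 0)
    {a b : Fin n → ℝ} (ha : a ∈ U \ B) (hb : b ∈ U \ B) (hab : a ≠ b) (hfab : f a = f b) :
    ∃ a' ∈ U \ B, ∃ b' ∈ U \ B, a' ≠ b' ∧ f a' = f b' ∧
      Ioo (0 : ℝ) 1 ⊆ closure {t ∈ Ioo (0 : ℝ) 1 | a' + t • (b' - a') ∈ U \ B} := by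
  set W := U \ B with hWdef
  let V : Set ((Fin n → ℝ) × (Fin n → ℝ)) := W ×ˢ W ∩ {z | z.1 ≠ z.2}
  have hV : IsOpen V :=
    (hW.prod hW).inter (isOpen_ne_fun continuous_fst continuous_snd)
  let M : Set ((Fin n → ℝ) × (Fin n → ℝ)) := {z | z ∈ V ∧ f z.1 - f z.2 = 0}
  have hφc : ContinuousOn (fun z : (Fin n → ℝ) × (Fin n → ℝ) => f z.1 - f z.2) V :=
    (hC1.continuousOn.comp continuousOn_fst fun z hz => hz.1.1).sub
      (hC1.continuousOn.comp continuousOn_snd fun z hz => hz.1.2)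
  have hM : IsLocallyClosed M := by
    obtain ⟨C, hC, hCV⟩ := continuousOn_iff_isClosed.1 hφc {0} isClosed_singleton
    refine ⟨V, C, hV, hC, ?_⟩
    rw [inter_comm V C, ← hCV, inter_comm]
    rfl
  have : LocallyCompactSpace M := hM.locallyCompactSpace
  -- Rational subintervals of `[0, 1]`; a pair in `G r` has a segment leaving `B` at some parameter in
  -- the interval `r`.
  let J := {r : ℚ × ℚ // 0 ≤ r.1 ∧ r.1 < r.2 ∧ r.2 ≤ 1}
  let G : J → Set M := fun r =>
    {z | ∃ t ∈ Ioo (r.1.1 : ℝ) r.1.2, z.1.1 + t • (z.1.2 - z.1.1) ∈ W}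
  have hGo : ∀ r, IsOpen (G r) := fun r => by
    have : G r = ⋃ t ∈ Ioo (r.1.1 : ℝ) r.1.2,
        (fun z : M => z.1.1 + t • (z.1.2 - z.1.1)) ⁻¹' W := by
      ext z; simp [G]
    rw [this]
    exact isOpen_biUnion fun t _ => hW.preimage (by fun_prop)
  have hGd : ∀ r, Dense (G r) := by
    rintro ⟨⟨p, q⟩, hp, hpq, hq⟩ ⟨⟨x, y⟩, ⟨⟨hx, hy⟩, hxy⟩, hfxy⟩
    have hx : x ∈ W := hx
    have hy : y ∈ W := hy
    have hp' : (0 : ℝ) ≤ p := by exact_mod_cast hp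
    have hq' : (q : ℝ) ≤ 1 := by exact_mod_cast hq
    have hpq' : (p : ℝ) < q := by exact_mod_cast hpq
    obtain ⟨t, htp, htq⟩ := exists_between hpq'
    have ht0 : 0 < t := hp'.trans_lt htp
    have ht1 : t < 1 := htq.trans_le hq'
    rw [mem_closure_iff_nhds]
    intro O hO
    obtain ⟨O', hO', hOO'⟩ := mem_nhds_subtype _ _ _ |>.1 hO
    -- `Φ` is a local homeomorphism at `(x, y)`, so the point at parameter `t` can be moved off `B`
    -- while the values of `f` at the two endpoints remain equal.
    let Φ : (Fin n → ℝ) × (Fin n → ℝ) → (Fin n → ℝ) × (Fin n → ℝ) :=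
      fun z => (f z.1 - f z.2, z.1 + t • (z.2 - z.1))
    let X := fderiv ℝ f x
    let Y := fderiv ℝ f y
    let fst := ContinuousLinearMap.fst ℝ (Fin n → ℝ) (Fin n → ℝ)
    let snd := ContinuousLinearMap.snd ℝ (Fin n → ℝ) (Fin n → ℝ)
    let Φ' := (X ∘L fst - Y ∘L snd).prod (fst + t • (snd - fst))
    have hsx : HasStrictFDerivAt f X (x, y).1 :=
      (hC1.contDiffAt (hW.mem_nhds hx)).hasStrictFDerivAt one_ne_zero
    have hsy : HasStrictFDerivAt f Y (x, y).2 :=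
      (hC1.contDiffAt (hW.mem_nhds hy)).hasStrictFDerivAt one_ne_zero
    have hΦ : HasStrictFDerivAt Φ Φ' (x, y) :=
      ((hsx.comp (x, y) fst.hasStrictFDerivAt).sub (hsy.comp (x, y) snd.hasStrictFDerivAt)).prodMk
        (fst + t • (snd - fst)).hasStrictFDerivAt
    have hsurj : Φ'.range = ⊤ := by
      rw [LinearMap.range_eq_top]
      refine LinearMap.injective_iff_surjective.1 ?_
      refine (injective_iff_map_eq_zero _).2 fun v hv => ?_
      obtain ⟨u, v⟩ := v
      have h1 : X u - Y v = 0 := congrArg Prod.fst hv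
      have h2 : u + t • (v - u) = 0 := congrArg Prod.snd hv
      have hA : t • jacobiMatrix f x + (1 - t) • jacobiMatrix f y ∈
          convexHull ℝ (jacobiMatrix f '' W) :=
        convex_convexHull ℝ _ (subset_convexHull ℝ _ (mem_image_of_mem _ hx))
          (subset_convexHull ℝ _ (mem_image_of_mem _ hy)) ht0.le (sub_pos.2 ht1).le (by ring)
      have hu : u = 0 := by
        refine Matrix.eq_zero_of_mulVec_eq_zero (hCr _ hA) ?_
        rw [Matrix.add_mulVec, Matrix.smul_mulVec, Matrix.smul_mulVec,
          jacobiMatrix_mulVec, jacobiMatrix_mulVec]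
        change t • X u + (1 - t) • Y u = 0
        rw [sub_eq_zero.1 h1, ← map_smul, ← map_smul, ← map_add]
        have : t • v + (1 - t) • u = u + t • (v - u) := by module
        rw [this, h2, map_zero]
      have hv' : v = 0 := by
        rw [hu] at h2
        simpa [ht0.ne'] using h2
      rw [hu, hv']
      rfl
    have hmap := hΦ.map_nhds_eq_of_surj hsurj
    have h1 : Φ '' (O' ∩ V) ∈ 𝓝 (Φ (x, y)) := by
      rw [← hmap]
      exact image_mem_map (inter_mem hO' (hV.mem_nhds ⟨⟨hx, hy⟩, hxy⟩))
    have hΦxy : Φ (x, y) = (0, x + t • (y - x)) := Prod.ext hfxy rfl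
    rw [hΦxy] at h1
    have h2 : {c | ((0 : Fin n → ℝ), c) ∈ Φ '' (O' ∩ V)} ∈ 𝓝 (x + t • (y - x)) :=
      (Continuous.prodMk_right (0 : Fin n → ℝ)).continuousAt.preimage_mem_nhds h1
    have hdense : Dense (closure B)ᶜ := interior_eq_empty_iff_dense_compl.1 hBnd
    obtain ⟨c, ⟨z, ⟨hzO, hzV⟩, hzc⟩, hcB⟩ := mem_closure_iff_nhds.1 (hdense _) _ h2
    have hz1 : f z.1 - f z.2 = 0 := congrArg Prod.fst hzc
    have hz2 : z.1 + t • (z.2 - z.1) = c := congrArg Prod.snd hzc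
    refine ⟨⟨z, hzV, hz1⟩, hOO' hzO, t, ⟨htp, htq⟩, ?_⟩
    change z.1 + t • (z.2 - z.1) ∈ W
    refine ⟨hUc.add_smul_sub_mem hzV.1.1.1 hzV.1.2.1 ⟨ht0.le, ht1.le⟩, ?_⟩
    rw [hz2]
    exact fun h => hcB (subset_closure h)
  have : Nonempty M := ⟨⟨(a, b), ⟨⟨ha, hb⟩, hab⟩, sub_eq_zero.2 hfab⟩⟩
  obtain ⟨⟨⟨a', b'⟩, ⟨⟨ha', hb'⟩, hab'⟩, hfab'⟩, hz⟩ := (dense_iInter_of_isOpen hGo hGd).nonempty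
  rw [mem_iInter] at hz
  refine ⟨a', ha', b', hb', hab', sub_eq_zero.1 hfab', fun t ht => ?_⟩
  rw [mem_closure_iff_nhds]
  intro O hO
  obtain ⟨c, d, ⟨htc, htd⟩, hcd⟩ := mem_nhds_iff_exists_Ioo_subset.1
    (inter_mem hO (isOpen_Ioo.mem_nhds ht))
  obtain ⟨p, hp1, hp2⟩ := exists_rat_btwn (max_lt htc ht.1)
  obtain ⟨q, hq1, hq2⟩ := exists_rat_btwn (lt_min htd ht.2)
  rw [max_lt_iff] at hp1
  rw [lt_min_iff] at hq2
  obtain ⟨s, ⟨hs1, hs2⟩, hsW⟩ := hz ⟨(p, q), by exact_mod_cast hp1.2.le,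
    by exact_mod_cast hp2.trans hq1, by exact_mod_cast hq2.2.le⟩
  have hs := hcd ⟨hp1.1.trans hs1, hs2.trans hq2.1⟩
  exact ⟨s, hs.1, hs.2, hsW⟩

theorem theorem3p3 (n : ℕ) (U B : Set (Fin n → ℝ)) (f : (Fin n → ℝ) → (Fin n → ℝ))
    (hUo : IsOpen U) (hUc : Convex ℝ U)
    (hfc : ContinuousOn f U) (hft : IsTameOn f U)
    (hBU : B ⊆ U) (hBcl : IsClosed {x : U | (x : Fin n → ℝ) ∈ B}) (hBnd : IsNowhereDense B)
    (hC1 : ContDiffOn ℝ 1 f (U \ B))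
    (himm : ∀ x ∈ U \ B, (jacobiMatrix f x).det ≠ 0)
    (hCr : ∀ A ∈ convexHull ℝ (jacobiMatrix f '' (U \ B)), A.det ≠ 0)
    (hI : Set.InjOn f B) :
    Set.InjOn f U := by
  have hW : IsOpen (U \ B) := by
    have h1 := hUo.isOpenMap_subtype_val _ hBcl.isOpen_compl
    convert h1 using 1
    ext x
    simp only [Set.mem_sdiff, mem_image, mem_compl_iff, mem_ofPred_eq, Subtype.exists,
      exists_and_left, exists_prop, exists_eq_right_right]
    exact and_comm
  intro x hx y hy hfxy
  by_contra hxy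
  obtain ⟨a₀, ha₀, b₀, hb₀, hab₀, hfab₀⟩ :
      ∃ a ∈ U \ B, ∃ b ∈ U \ B, a ≠ b ∧ f a = f b := by
    by_cases hxB : x ∈ B
    · have hyB : y ∉ B := fun hyB => hxy (hI hxB hyB hfxy)
      exact exists_ne_eq_of_mem_diff hUo hfc hW hBnd hC1 himm ⟨hy, hyB⟩ hx (Ne.symm hxy) hfxy.symm
    · exact exists_ne_eq_of_mem_diff hUo hfc hW hBnd hC1 himm ⟨hx, hxB⟩ hy hxy hfxy
  obtain ⟨a, ha, b, hb, hab, hfab, hD⟩ :=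
    exists_segment_dense_diff hUc hW hBnd hC1 hCr ha₀ hb₀ hab₀ hfab₀
  set w := b - a with hw
  have hw0 : w ≠ 0 := sub_ne_zero.2 hab.symm
  set D : Set ℝ := {t ∈ Ioo (0 : ℝ) 1 | a + t • w ∈ U \ B} with hDdef
  have hDI : D ⊆ Ioo 0 1 := fun t ht => ht.1
  have hDo : IsOpen D := isOpen_Ioo.inter (hW.preimage (by fun_prop))
  have hDne : D.Nonempty :=
    closure_nonempty_iff.1 ⟨1 / 2, hD ⟨by norm_num, by norm_num⟩⟩
  have hseg : ∀ t ∈ Icc (0 : ℝ) 1, a + t • w ∈ U := fun t ht =>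
    hUc.add_smul_sub_mem ha.1 hb.1 ht
  have hC1D : ∀ t ∈ D, ContDiffAt ℝ 1 (fun s : ℝ => f (a + s • w)) t := fun t ht =>
    ContDiffAt.comp (g := f) t (hC1.contDiffAt (hW.mem_nhds ht.2)) (by fun_prop)
  have hder : ∀ t ∈ D, HasDerivAt (fun s : ℝ => f (a + s • w))
      ((jacobiMatrix f (a + t • w)).mulVec w) t := fun t ht => by
    rw [jacobiMatrix_mulVec]
    have h1 : HasDerivAt (fun s : ℝ => a + s • w) w t := by
      simpa using ((hasDerivAt_id t).smul_const w).const_add a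
    have h2 := ((hC1.contDiffAt (hW.mem_nhds ht.2)).differentiableAt one_ne_zero).hasFDerivAt
    exact h2.comp_hasDerivAt t h1
  have hzero := zero_mem_convexHull_image_deriv (g := fun s : ℝ => f (a + s • w))
    (hfc.comp (by fun_prop) hseg) (by simpa [hw] using hfab) hDI hDo hDne hder
    fun l hl => hft.locally_monotone_off_countable hfc l hw0
      (fun t ht => hseg t ⟨ht.1.le, ht.2.le⟩) hD hDI hC1D fun t ht => by
        have h1 : HasDerivAt (fun s : ℝ => l (f (a + s • w)))
            (l ((jacobiMatrix f (a + t • w)).mulVec w)) t :=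
          (LinearMap.toContinuousLinearMap l).hasFDerivAt.comp_hasDerivAt t (hder t ht)
        rw [h1.deriv]
        exact hl t ht
  -- The velocities are the images of `w` under the Jacobi matrices, hence some matrix in their convex
  -- hull kills `w`.
  let ev : Matrix (Fin n) (Fin n) ℝ →ₗ[ℝ] (Fin n → ℝ) :=
    { toFun := fun A => A.mulVec w
      map_add' := fun A A' => Matrix.add_mulVec A A' w
      map_smul' := fun c A => Matrix.smul_mulVec c A w }
  have hsub : (fun t : ℝ => (jacobiMatrix f (a + t • w)).mulVec w) '' D ⊆
      ev '' (jacobiMatrix f '' (U \ B)) := by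
    rintro _ ⟨t, ht, rfl⟩
    exact ⟨_, ⟨_, ht.2, rfl⟩, rfl⟩
  have hzero' := convexHull_mono (𝕜 := ℝ) hsub hzero
  rw [← ev.image_convexHull] at hzero'
  obtain ⟨A, hA, hAw⟩ := hzero'
  exact hw0 (Matrix.eq_zero_of_mulVec_eq_zero (hCr A hA) hAw)
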